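/- Let $n$ agents hold opinions on $d$ topics; write $x_{i,p}\in\mathbb R$ for the opinion of agent $i$ on topic $p$, $x_i=(x_{i,1},\dots,x_{i,d})^T$ and $x=(x_1^T,\dots,x_n^T)^T\in\mathbb R^{nd}$. For agents $i,j$ let $K^{i,j}=[k^{i,j}_{p,q}]\in\mathbb R^{d\times d}$ be constant coupling matrices with $k^{i,j}_{p,q}\ge 0$ and $k^{i,j}_{p,q}=k^{j,i}_{p,q}=k^{i,j}_{q,p}$. Fix $k_e>0$ and let $\operatorname{sign}(z)=\frac{2}{1+e^{-k_e z}}-1$ be the smooth sign function. The state-dependent weighting matrix $A^{i,j}(x)=[a^{i,j}_{p,q}]$ is given, with $z_p=x_{j,p}-x_{i,p}$, by one of the following cooperative feedback laws: * inverse-proportional: $a^{i,j}_{p,q}=k^{i,j}_{p,q}\operatorname{sign}(z_p)\operatorname{sign}(z_q)$ for $p\ne q$, and either $a^{i,j}_{p,p}=k^{i,j}_{p,p}$ or $a^{i,j}_{p,p}=k^{i,j}_{p,p}\operatorname{sign}(z_p)^2$; * proportional, with constants $c_0,c_1>0$, $c_2\ge 0$: $a^{i,j}_{p,q}=\dfrac{k^{i,j}_{p,q}\operatorname{sign}(z_p)\operatorname{sign}(z_q)}{(c_1|z_p|+c_0)(c_1|z_q|+c_0)}$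 for $p\neq q$, and either $a^{i,j}_{p,p}=\dfrac{k^{i,j}_{p,p}}{c_2|z_p|^2+c_1|z_p|+c_0}$ or $a^{i,j}_{p,p}=\dfrac{k^{i,j}_{p,p}\operatorname{sign}(z_p)^2}{(c_1|z_p|+c_0)^2}$. Agents $i\ne j$ are neighbors, $j\in\mathcal N_i$, if $A^{i,j}$ is not identically zero. Let $\mathbb L(x)\in\mathbb R^{nd\times nd}$ be the matrix-weighted Laplacian with diagonal blocks $\sum_{j\in\mathcal N_i}A^{i,j}(x)$ and off-diagonal blocks $-A^{i,j}(x)$, and assume that $\mathbb L(y)$ is positive semidefinite for every $y\in\mathbb R^{nd}$. Let $x(t)$, $t\ge t_0$, be any solution of $\dot x=-\mathbb L(x)x$, and let $i$ and $j$ be neighboring agents. Then: 1. if topics $p$ and $q$ are coupled on the edge $(i,j)$, i.e. $k^{i,j}_{p,q}\ne 0$, then $x_{i,p}$ and $x_{j,p}$ reach a consensus, and $x_{i,q}$ and $x_{j,q}$ reach a consensus; 2. if $k^{i,j}_{p,p}\neq 0$, then $x_{i,p}$ and $x_{j,p}$ reach a consensus. Here $x_{i,p}$ and $x_{j,p}$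 reach a consensus if $x_{i,p}(t)$ and $x_{j,p}(t)$ converge to a common limit as $t\to\infty$. -/

import Mathlib

open Filter Topology

noncomputable section

/-- The smooth sign function `2 / (1 + exp (-kₑ z)) - 1`. -/
def smoothSign (ke z : ℝ) : ℝ := 2 / (1 + Real.exp (-(ke * z))) - 1

theorem smoothSign_neg (ke z : ℝ) : smoothSign ke (-z) = -smoothSign ke z := by
  unfold smoothSign
  have h1 : 0 < Real.exp (-(ke * z)) := Real.exp_pos _
  have h2 : Real.exp (-(ke * -z)) = (Real.exp (-(ke * z)))⁻¹ := by
    rw [← Real.exp_neg]; congr 1; ring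
  rw [h2]
  field_simp
  ring

/-- The cooperative feedback laws. For the inverse-proportional and for the proportional law, the
direct term (same topic) is either the one without the sign factor, or the one in which the square
of the (smooth) sign appears, so that the weighting matrix factors as `diag S * K * diag S`. -/
inductive Feedback where
  | inverse
  | inverseSigned
  | proportional (c₀ c₁ c₂ : ℝ) (h₀ : 0 < c₀) (h₁ : 0 < c₁) (h₂ : 0 ≤ c₂)
  | proportionalSigned (c₀ c₁ : ℝ) (h₀ : 0 < c₀) (h₁ : 0 < c₁)

namespace Feedback

/-- The factor `g` in the cross coupling `a_{p,q} = k_{p,q} * g (z p) * g (z q)`, `p ≠ q`. -/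
def crossGain (ke : ℝ) : Feedback → ℝ → ℝ
  | inverse, z => smoothSign ke z
  | inverseSigned, z => smoothSign ke z
  | proportional c₀ c₁ _ _ _ _, z => smoothSign ke z / (c₁ * |z| + c₀)
  | proportionalSigned c₀ c₁ _ _, z => smoothSign ke z / (c₁ * |z| + c₀)

/-- The factor `f` in the direct coupling `a_{p,p} = k_{p,p} * f (z p)`. -/
def directGain (ke : ℝ) : Feedback → ℝ → ℝ
  | inverse, _ => 1
  | inverseSigned, z => smoothSign ke z ^ 2
  | proportional c₀ c₁ c₂ _ _ _, z => 1 / (c₂ * |z| ^ 2 + c₁ * |z| + c₀)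
  | proportionalSigned c₀ c₁ _ _, z => (smoothSign ke z / (c₁ * |z| + c₀)) ^ 2

theorem crossGain_neg (ke : ℝ) (law : Feedback) (z : ℝ) :
    law.crossGain ke (-z) = -law.crossGain ke z := by
  cases law <;> simp [crossGain, smoothSign_neg, neg_div]

theorem directGain_neg (ke : ℝ) (law : Feedback) (z : ℝ) :
    law.directGain ke (-z) = law.directGain ke z := by
  cases law <;> simp [directGain, smoothSign_neg, neg_div]

end Feedback

/-- The constant coupling matrices `K i j` of a cooperative network of `n` agents and `d` topics:
their entries are non-negative (an entry is zero when the two topics are not coupled on the edge)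
and symmetric both in the agents and in the topics. -/
structure OpinionNetwork (n d : ℕ) where
  K : Fin n → Fin n → Matrix (Fin d) (Fin d) ℝ
  nonneg : ∀ i j p q, 0 ≤ K i j p q
  symm_agents : ∀ i j p q, K i j p q = K j i p q
  symm_topics : ∀ i j p q, K i j p q = K i j q p

/-- The stacked opinion vector; `x (i, p)` is the opinion of agent `i` on topic `p`. -/
abbrev OpinionState (n d : ℕ) : Type := Fin n × Fin d → ℝ

namespace OpinionNetwork

variable {n d : ℕ}

/-- The state-dependent weighting matrix `A^{i,j}` at the state `x`. -/
def weight (N : OpinionNetwork n d) (law : Feedback) (ke : ℝ) (i j : Fin n)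
    (x : OpinionState n d) : Matrix (Fin d) (Fin d) ℝ :=
  Matrix.of fun p q =>
    if p = q then N.K i j p p * law.directGain ke (x (j, p) - x (i, p))
    else N.K i j p q * law.crossGain ke (x (j, p) - x (i, p))
      * law.crossGain ke (x (j, q) - x (i, q))

theorem weight_comm (N : OpinionNetwork n d) (law : Feedback) (ke : ℝ) (i j : Fin n)
    (x : OpinionState n d) : N.weight law ke i j x = N.weight law ke j i x := by
  ext p q
  have h : ∀ r, x (j, r) - x (i, r) = -(x (i, r) - x (j, r)) := fun r => by ring
  simp only [weight, Matrix.of_apply, h, Feedback.crossGain_neg, Feedback.directGain_neg,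
    N.symm_agents i j]
  split_ifs <;> ring

/-- Two different agents are neighbors when `A^{i,j}` is not identically zero. -/
def interactionGraph (N : OpinionNetwork n d) (law : Feedback) (ke : ℝ) :
    SimpleGraph (Fin n) where
  Adj i j := i ≠ j ∧ ∃ x, N.weight law ke i j x ≠ 0
  symm := ⟨fun i j h => ⟨h.1.symm, h.2.imp fun x hx => by rwa [N.weight_comm law ke j i x]⟩⟩
  loopless := ⟨fun _ h => h.1 rfl⟩

open Classical in
/-- The matrix-weighted Laplacian: the diagonal block of agent `i` is the sum of `A^{i,j}` over
the neighbors `j` of `i`, and the block at `(i, j)`, `i ≠ j`, is `-A^{i,j}`. -/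
def laplacian (N : OpinionNetwork n d) (law : Feedback) (ke : ℝ) (x : OpinionState n d) :
    Matrix (Fin n × Fin d) (Fin n × Fin d) ℝ :=
  Matrix.of fun a b =>
    if a.1 = b.1 then
      ∑ j with (N.interactionGraph law ke).Adj a.1 j, N.weight law ke a.1 j x a.2 b.2
    else -N.weight law ke a.1 b.1 x a.2 b.2

/-- `x` solves `ẋ = -L(x) x` on `[t₀, ∞)`. -/
def IsTrajectory (N : OpinionNetwork n d) (law : Feedback) (ke t₀ : ℝ)
    (x : ℝ → OpinionState n d) : Prop :=
  ∀ t, t₀ ≤ t →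
    HasDerivWithinAt x (-(Matrix.mulVec (N.laplacian law ke (x t)) (x t))) (Set.Ici t₀) t

end OpinionNetwork

/-- Along `x`, the opinions of agents `i` and `j` on topic `p` converge to a common value. -/
def ReachConsensus {n d : ℕ} (x : ℝ → OpinionState n d) (i j : Fin n) (p : Fin d) : Prop :=
  ∃ c : ℝ, Tendsto (fun t => x t (i, p)) atTop (𝓝 c) ∧ Tendsto (fun t => x t (j, p)) atTop (𝓝 c)

end

/-!
For each topic `p` let `G_p` be the graph on the agents whose edges are the pairs with
`K i j p p ≠ 0` (`OpinionNetwork.topicGraph`). The result is that every `x_{i,p}` converges to the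
initial average of topic `p` over the component of `i` in `G_p`, together with the fact that any
coupling `K i j p q ≠ 0` forces `i` and `j` into the same component of `G_p`.

Everything rests on the identity
`2 uᵀ L(y) v = ∑ i j p q, A^{i,j}(y)_{p,q} (u_{i,p} - u_{j,p}) (v_{i,q} - v_{j,q})`
(`OpinionNetwork.two_mul_dotProduct_laplacian_mulVec`), used in two ways.

* For `u = v = y = x` all summands are non-negative, because the cross gain has the sign of its
  argument. So `|x|²` decreases with speed `2 xᵀ L(x) x`, the trajectory is bounded, and
  Barbalat's lemma (`tendsto_zero_of_antideriv_nonneg`) gives `xᵀ L(x) x → 0`. Each summand with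
  `p = q` tends to `0` as well, hence `x_{i,p} - x_{j,p} → 0` along the edges of `G_p`.
* For `u = v = 1_C e_p` with `C` a component of `G_p`, the form vanishes, so positive
  semidefiniteness gives `L(y) v = 0` for *every* `y`
  (`OpinionNetwork.laplacian_mulVec_componentVector`). Applied along the trajectory, this conserves
  the sum of topic `p` over `C`. Applied to the state `y` which is `0` at agent `i` and `1`
  elsewhere, it exhibits a vanishing sum of non-negative terms `K i j p q g(1)²` over `j ∉ C`, so
  no coupling leaves `C`. This second use is where a coupling `K i j p q ≠ 0` with
  `K i j p p = 0` is dealt with: the two agents are then still joined by a path in `G_p`.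
-/

/-! ### Two facts about limits -/

/-- Barbalat's lemma, in the form used for Lyapunov functions: if `V ≥ 0` decreases with speed
`h ≥ 0` and `h` is uniformly continuous, then `h → 0`. -/
theorem tendsto_zero_of_antideriv_nonneg {V h : ℝ → ℝ} {t₀ : ℝ}
    (hV : ∀ t, t₀ ≤ t → HasDerivWithinAt V (-h t) (Set.Ici t₀) t)
    (hV0 : ∀ t, t₀ ≤ t → 0 ≤ V t) (hh : ∀ t, t₀ ≤ t → 0 ≤ h t)
    (huc : UniformContinuousOn h (Set.Ici t₀)) :
    Tendsto h atTop (𝓝 0) := by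
  have hcont : ContinuousOn V (Set.Ici t₀) := fun t ht => (hV t ht).continuousWithinAt
  have hderiv : ∀ t, t₀ < t → HasDerivAt V (-h t) t := fun t ht =>
    (hV t ht.le).hasDerivAt (Ici_mem_nhds ht)
  have hanti : AntitoneOn V (Set.Ici t₀) := by
    refine antitoneOn_of_deriv_nonpos (convex_Ici t₀) hcont ?_ ?_
    · intro t ht
      rw [interior_Ici] at ht
      exact (hderiv t ht).differentiableAt.differentiableWithinAt
    · intro t ht
      rw [interior_Ici] at ht
      rw [(hderiv t ht).deriv]
      linarith [hh t (le_of_lt ht)]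
  obtain ⟨l, hl⟩ : ∃ l, Tendsto V atTop (𝓝 l) := by
    have hm : Antitone fun t => V (max t t₀) := fun s t hst =>
      hanti (Set.mem_Ici.2 (le_max_right _ _)) (Set.mem_Ici.2 (le_max_right _ _))
        (max_le_max_right _ hst)
    have hb : BddBelow (Set.range fun t => V (max t t₀)) :=
      ⟨0, by rintro _ ⟨t, rfl⟩; exact hV0 _ (le_max_right _ _)⟩
    refine ⟨_, (tendsto_atTop_ciInf hm hb).congr' ?_⟩
    filter_upwards [eventually_ge_atTop t₀] with t ht
    rw [max_eq_left ht]
  rw [Metric.tendsto_atTop]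
  intro ε hε
  obtain ⟨δ, hδ, hδh⟩ := Metric.uniformContinuousOn_iff.1 huc (ε / 2) (by positivity)
  have hdiff : Tendsto (fun t => V t - V (t + δ / 2)) atTop (𝓝 0) := by
    simpa using hl.sub (hl.comp (tendsto_atTop_add_const_right _ (δ / 2) tendsto_id))
  have hev := hdiff.eventually (gt_mem_nhds (show (0 : ℝ) < ε / 2 * (δ / 2) by positivity))
  obtain ⟨T, hT⟩ := eventually_atTop.1 (hev.and (eventually_ge_atTop t₀))
  refine ⟨T, fun t ht => ?_⟩
  obtain ⟨h1, h2⟩ := hT t ht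
  rw [Real.dist_eq, sub_zero, abs_of_nonneg (hh t h2)]
  by_contra! hbig
  -- If `h t ≥ ε`, then `h ≥ ε / 2` on `[t, t + δ / 2]`, and `V` drops by at least `ε δ / 4` there.
  have hmv := exists_hasDerivAt_eq_slope V (fun s => -h s) (show t < t + δ / 2 by linarith)
    (hcont.mono fun s hs => le_trans h2 hs.1) fun s hs => hderiv s (lt_of_le_of_lt h2 hs.1)
  obtain ⟨s, ⟨hs1, hs2⟩, hs⟩ := hmv
  have hd := hδh t h2 s (le_trans h2 hs1.le)
    (by rw [Real.dist_eq, abs_lt]; constructor <;> linarith)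
  rw [Real.dist_eq, abs_lt] at hd
  rw [eq_div_iff (by linarith)] at hs
  nlinarith [hd.1, hd.2]

theorem tendsto_zero_of_comp_tendsto_zero {α : Type*} {l : Filter α} {z : α → ℝ} {φ : ℝ → ℝ}
    {B : ℝ} (hφ : Continuous φ) (hφ0 : ∀ a, φ a = 0 → a = 0) (hz : ∀ᶠ t in l, |z t| ≤ B)
    (h : Tendsto (fun t => φ (z t)) l (𝓝 0)) : Tendsto z l (𝓝 0) := by
  refine (isCompact_Icc (a := -B) (b := B)).tendsto_nhds_of_unique_mapClusterPt
    (hz.mono fun t ht => abs_le.1 ht) fun a _ ha => hφ0 a ?_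
  have h1 : MapClusterPt (φ a) l (φ ∘ z) := ha.continuousAt_comp hφ.continuousAt
  have : (𝓝 (φ a) ⊓ 𝓝 0).NeBot := NeBot.mono h1 (inf_le_inf_left _ h)
  exact eq_of_nhds_neBot this

/-! ### The gains -/

theorem continuous_smoothSign (ke : ℝ) : Continuous (smoothSign ke) := by
  unfold smoothSign
  refine (continuous_const.div (by fun_prop) fun z => ?_).sub continuous_const
  positivity

theorem smoothSign_pos {ke z : ℝ} (hke : 0 < ke) (hz : 0 < z) : 0 < smoothSign ke z := by
  unfold smoothSign
  have h : Real.exp (-(ke * z)) < 1 := by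
    rw [Real.exp_lt_one_iff]
    linarith [mul_pos hke hz]
  rw [sub_pos, lt_div_iff₀ (by positivity)]
  linarith

namespace Feedback

theorem continuous_crossGain (ke : ℝ) (law : Feedback) : Continuous (law.crossGain ke) := by
  have hs := continuous_smoothSign ke
  cases law with
  | inverse => exact hs
  | inverseSigned => exact hs
  | proportional c₀ c₁ c₂ h₀ h₁ h₂ =>
    exact hs.div (by fun_prop) fun z => by positivity
  | proportionalSigned c₀ c₁ h₀ h₁ =>
    exact hs.div (by fun_prop) fun z => by positivity

theorem continuous_directGain (ke : ℝ) (law : Feedback) : Continuous (law.directGain ke) := by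
  have hs := continuous_smoothSign ke
  cases law with
  | inverse => exact continuous_const
  | inverseSigned => exact hs.pow 2
  | proportional c₀ c₁ c₂ h₀ h₁ h₂ =>
    exact continuous_const.div (by fun_prop) fun z => by positivity
  | proportionalSigned c₀ c₁ h₀ h₁ =>
    exact (hs.div (by fun_prop) fun z => by positivity).pow 2

theorem crossGain_pos {ke z : ℝ} (hke : 0 < ke) (law : Feedback) (hz : 0 < z) :
    0 < law.crossGain ke z := by
  have hs := smoothSign_pos hke hz
  cases law with
  | inverse => exact hs
  | inverseSigned => exact hs
  | proportional c₀ c₁ c₂ h₀ h₁ h₂ => exact div_pos hs (by positivity)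
  | proportionalSigned c₀ c₁ h₀ h₁ => exact div_pos hs (by positivity)

theorem crossGain_mul_self_nonneg {ke : ℝ} (hke : 0 < ke) (law : Feedback) (z : ℝ) :
    0 ≤ law.crossGain ke z * z := by
  rcases lt_trichotomy z 0 with hz | rfl | hz
  · have h := law.crossGain_pos hke (neg_pos.2 hz)
    rw [crossGain_neg] at h
    nlinarith
  · simp
  · exact (mul_pos (law.crossGain_pos hke hz) hz).le

theorem directGain_nonneg (ke : ℝ) (law : Feedback) (z : ℝ) : 0 ≤ law.directGain ke z := by
  cases law <;> simp only [directGain] <;> positivity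

theorem directGain_pos {ke z : ℝ} (hke : 0 < ke) (law : Feedback) (hz : z ≠ 0) :
    0 < law.directGain ke z := by
  wlog hpos : 0 < z generalizing z
  · rw [← directGain_neg]
    exact this (neg_ne_zero.2 hz) (neg_pos.2 (lt_of_le_of_ne (not_lt.1 hpos) hz))
  have hs := smoothSign_pos hke hpos
  cases law <;> simp only [directGain] <;> positivity

end Feedback

namespace OpinionNetwork

variable {n d : ℕ}

/-! ### The quadratic form of the Laplacian -/

theorem continuous_weight (N : OpinionNetwork n d) (law : Feedback) (ke : ℝ) (i j : Fin n)
    (p q : Fin d) : Continuous fun x => N.weight law ke i j x p q := by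
  have h1 := law.continuous_crossGain ke
  have h2 := law.continuous_directGain ke
  simp only [weight, Matrix.of_apply]
  split_ifs <;> fun_prop

/-- The sum runs over all agents: the term `j = i` cancels, and non-neighbors have weight zero. -/
theorem laplacian_mulVec_apply (N : OpinionNetwork n d) (law : Feedback) (ke : ℝ)
    (y v : OpinionState n d) (i : Fin n) (p : Fin d) :
    (N.laplacian law ke y).mulVec v (i, p) =
      ∑ j, ∑ q, N.weight law ke i j y p q * (v (i, q) - v (j, q)) := by
  classical
  have hadj : ∀ j, j ≠ i → ¬(N.interactionGraph law ke).Adj i j →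
      N.weight law ke i j y = 0 := fun j hj h => by
    by_contra hw
    exact h ⟨hj.symm, y, hw⟩
  have hdiag : ∀ q, (∑ j with (N.interactionGraph law ke).Adj i j, N.weight law ke i j y p q) =
      ∑ j ∈ Finset.univ.erase i, N.weight law ke i j y p q := fun q => by
    refine Finset.sum_subset (fun j hj => ?_) fun j hj hj' => ?_
    · exact Finset.mem_erase.2 ⟨(Finset.mem_filter.1 hj).2.ne', Finset.mem_univ _⟩
    · rw [hadj j (Finset.mem_erase.1 hj).1 (by simpa using hj')]
      rfl
  rw [Matrix.mulVec, dotProduct, Fintype.sum_prod_type,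
    ← Finset.add_sum_erase _ _ (Finset.mem_univ i),
    ← Finset.add_sum_erase _ (fun j => ∑ q, N.weight law ke i j y p q * (v (i, q) - v (j, q)))
      (Finset.mem_univ i)]
  simp only [sub_self, mul_zero, Finset.sum_const_zero, zero_add, mul_sub, Finset.sum_sub_distrib]
  rw [sub_eq_add_neg, ← Finset.sum_neg_distrib]
  congr 1
  · rw [Finset.sum_comm]
    refine Finset.sum_congr rfl fun q _ => ?_
    rw [← Finset.sum_mul, ← hdiag]
    simp [laplacian]
  · refine Finset.sum_congr rfl fun j hj => ?_
    simp [laplacian, (Finset.mem_erase.1 hj).1.symm]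

theorem two_mul_dotProduct_laplacian_mulVec (N : OpinionNetwork n d) (law : Feedback) (ke : ℝ)
    (y u v : OpinionState n d) :
    2 * (u ⬝ᵥ (N.laplacian law ke y).mulVec v) =
      ∑ i, ∑ j, ∑ p, ∑ q,
        N.weight law ke i j y p q * (u (i, p) - u (j, p)) * (v (i, q) - v (j, q)) := by
  have h1 : u ⬝ᵥ (N.laplacian law ke y).mulVec v = ∑ i, ∑ j, ∑ p, ∑ q,
      N.weight law ke i j y p q * u (i, p) * (v (i, q) - v (j, q)) := by
    rw [dotProduct, Fintype.sum_prod_type]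
    refine Finset.sum_congr rfl fun i _ => ?_
    rw [Finset.sum_comm]
    refine Finset.sum_congr rfl fun p _ => ?_
    rw [laplacian_mulVec_apply, Finset.mul_sum]
    refine Finset.sum_congr rfl fun j _ => ?_
    rw [Finset.mul_sum]
    exact Finset.sum_congr rfl fun q _ => by ring
  have h2 : u ⬝ᵥ (N.laplacian law ke y).mulVec v = ∑ i, ∑ j, ∑ p, ∑ q,
      N.weight law ke i j y p q * (-u (j, p)) * (v (i, q) - v (j, q)) := by
    rw [h1, Finset.sum_comm]
    refine Finset.sum_congr rfl fun i _ => Finset.sum_congr rfl fun j _ =>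
      Finset.sum_congr rfl fun p _ => Finset.sum_congr rfl fun q _ => ?_
    rw [N.weight_comm law ke j i]
    ring
  rw [two_mul]
  nth_rewrite 1 [h1]
  rw [h2]
  simp only [← Finset.sum_add_distrib]
  refine Finset.sum_congr rfl fun i _ => Finset.sum_congr rfl fun j _ =>
    Finset.sum_congr rfl fun p _ => Finset.sum_congr rfl fun q _ => ?_
  ring

theorem continuous_laplacian_mulVec (N : OpinionNetwork n d) (law : Feedback) (ke : ℝ) :
    Continuous fun y : OpinionState n d => (N.laplacian law ke y).mulVec y := by
  refine continuous_pi fun a => ?_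
  have h := fun j q => N.continuous_weight law ke a.1 j a.2 q
  obtain ⟨i, p⟩ := a
  simp only [laplacian_mulVec_apply]
  fun_prop

/-- At `u = v = y` the summands are non-negative, as the cross gain has the sign of its
argument. -/
theorem weight_mul_diff_mul_diff_nonneg (N : OpinionNetwork n d) {ke : ℝ} (hke : 0 < ke)
    (law : Feedback) (y : OpinionState n d) (i j : Fin n) (p q : Fin d) :
    0 ≤ N.weight law ke i j y p q * (y (i, p) - y (j, p)) * (y (i, q) - y (j, q)) := by
  by_cases h : p = q
  · subst h
    simp only [weight, Matrix.of_apply, if_true, mul_assoc]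
    exact mul_nonneg (N.nonneg _ _ _ _)
      (mul_nonneg (law.directGain_nonneg _ _) (mul_self_nonneg _))
  · have h1 := law.crossGain_mul_self_nonneg hke (y (j, p) - y (i, p))
    have h2 := law.crossGain_mul_self_nonneg hke (y (j, q) - y (i, q))
    simp only [weight, Matrix.of_apply, h, if_false]
    calc 0 ≤ N.K i j p q * ((law.crossGain ke (y (j, p) - y (i, p)) * (y (j, p) - y (i, p))) *
          (law.crossGain ke (y (j, q) - y (i, q)) * (y (j, q) - y (i, q)))) :=
          mul_nonneg (N.nonneg _ _ _ _) (mul_nonneg h1 h2)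
      _ = _ := by ring

theorem directGain_mul_sq_le (N : OpinionNetwork n d) {ke : ℝ} (hke : 0 < ke)
    (law : Feedback) (y : OpinionState n d) (i j : Fin n) (p : Fin d) :
    N.K i j p p * (law.directGain ke (y (j, p) - y (i, p)) * (y (j, p) - y (i, p)) ^ 2) ≤
      2 * (y ⬝ᵥ (N.laplacian law ke y).mulVec y) := by
  have h0 := N.weight_mul_diff_mul_diff_nonneg hke law y
  rw [two_mul_dotProduct_laplacian_mulVec]
  calc _ = N.weight law ke i j y p p * (y (i, p) - y (j, p)) * (y (i, p) - y (j, p)) := by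
        simp only [weight, Matrix.of_apply, if_true]
        ring
    _ ≤ ∑ q, N.weight law ke i j y p q * (y (i, p) - y (j, p)) * (y (i, q) - y (j, q)) :=
        Finset.single_le_sum (f := fun q => N.weight law ke i j y p q * (y (i, p) - y (j, p)) *
          (y (i, q) - y (j, q))) (fun q _ => h0 i j p q) (Finset.mem_univ p)
    _ ≤ ∑ p, ∑ q, N.weight law ke i j y p q * (y (i, p) - y (j, p)) * (y (i, q) - y (j, q)) :=
        Finset.single_le_sum (f := fun p => ∑ q, N.weight law ke i j y p q *
          (y (i, p) - y (j, p)) * (y (i, q) - y (j, q)))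
          (fun p _ => Finset.sum_nonneg fun q _ => h0 i j p q) (Finset.mem_univ p)
    _ ≤ ∑ j, ∑ p, ∑ q, N.weight law ke i j y p q *
          (y (i, p) - y (j, p)) * (y (i, q) - y (j, q)) :=
        Finset.single_le_sum (f := fun j => ∑ p, ∑ q, N.weight law ke i j y p q *
          (y (i, p) - y (j, p)) * (y (i, q) - y (j, q)))
          (fun j _ => Finset.sum_nonneg fun p _ => Finset.sum_nonneg fun q _ => h0 i j p q)
          (Finset.mem_univ j)
    _ ≤ _ :=
        Finset.single_le_sum (f := fun i => ∑ j, ∑ p, ∑ q, N.weight law ke i j y p q *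
          (y (i, p) - y (j, p)) * (y (i, q) - y (j, q)))
          (fun i _ => Finset.sum_nonneg fun j _ => Finset.sum_nonneg fun p _ =>
            Finset.sum_nonneg fun q _ => h0 i j p q)
          (Finset.mem_univ i)

/-! ### Components of a topic -/

/-- The graph of agents that are directly coupled in topic `p`, that is, `K i j p p ≠ 0`. -/
def topicGraph (N : OpinionNetwork n d) (p : Fin d) : SimpleGraph (Fin n) where
  Adj i j := i ≠ j ∧ N.K i j p p ≠ 0
  symm := ⟨fun i j h => ⟨h.1.symm, by rw [← N.symm_agents i j]; exact h.2⟩⟩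
  loopless := ⟨fun _ h => h.1 rfl⟩

open Classical in
/-- The vector `1_C e_p`, where `C` is the component of agent `i` in the graph of topic `p`. -/
noncomputable def componentVector (N : OpinionNetwork n d) (p : Fin d) (i : Fin n) :
    OpinionState n d :=
  fun a => if a.2 = p ∧ (N.topicGraph p).Reachable i a.1 then 1 else 0

theorem componentVector_sub_eq_zero_of_adj (N : OpinionNetwork n d) (p : Fin d) (i₀ : Fin n)
    {i j : Fin n} (h : (N.topicGraph p).Adj i j) (q : Fin d) :
    N.componentVector p i₀ (i, q) - N.componentVector p i₀ (j, q) = 0 := by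
  have : (N.topicGraph p).Reachable i₀ i ↔ (N.topicGraph p).Reachable i₀ j :=
    ⟨fun hi => hi.trans h.reachable, fun hj => hj.trans h.symm.reachable⟩
  by_cases hj : (N.topicGraph p).Reachable i₀ j <;> simp [componentVector, this, hj]

theorem laplacian_mulVec_componentVector (N : OpinionNetwork n d) {law : Feedback} {ke : ℝ}
    (hL : ∀ y : OpinionState n d, (N.laplacian law ke y).PosSemidef)
    (y : OpinionState n d) (p : Fin d) (i₀ : Fin n) :
    (N.laplacian law ke y).mulVec (N.componentVector p i₀) = 0 := by
  refine ((hL y).dotProduct_mulVec_zero_iff _).1 ?_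
  rw [star_trivial]
  have h := N.two_mul_dotProduct_laplacian_mulVec law ke y (N.componentVector p i₀)
    (N.componentVector p i₀)
  have h0 : ∀ r, r ≠ p → ∀ i, N.componentVector p i₀ (i, r) = 0 := fun r hr i => by
    simp [componentVector, hr]
  -- Only the terms with both topics equal to `p` remain, and there either the direct coupling
  -- vanishes or the two agents lie on the same side.
  rw [Finset.sum_eq_zero fun i _ => Finset.sum_eq_zero fun j _ => Finset.sum_eq_zero fun r _ =>
    Finset.sum_eq_zero fun q _ => ?_] at h
  · linarith
  · by_cases hr : r = p
    · by_cases hq : q = p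
      · subst hr
        subst hq
        by_cases hij : i = j
        · simp [hij]
        · by_cases hK : N.K i j q q = 0
          · simp [weight, hK]
          · rw [N.componentVector_sub_eq_zero_of_adj q i₀ ⟨hij, hK⟩ q, mul_zero]
      · simp [h0 q hq]
    · simp [h0 r hr]

/-- A coupling of the topic `p` with any topic never leaves a component of topic `p`. -/
theorem reachable_of_coupled (N : OpinionNetwork n d) {law : Feedback} {ke : ℝ} (hke : 0 < ke)
    (hL : ∀ y : OpinionState n d, (N.laplacian law ke y).PosSemidef)
    {i j : Fin n} {p q : Fin d} (h : N.K i j p q ≠ 0) : (N.topicGraph p).Reachable i j := by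
  classical
  by_contra hij
  have hne : i ≠ j := fun e => hij (e ▸ SimpleGraph.Reachable.refl _)
  have hpq : q ≠ p := fun e => by
    subst e
    exact hij (SimpleGraph.Adj.reachable ⟨hne, h⟩)
  -- All opinion differences seen from agent `i` are `1` here, so the row of `L` at `(i, q)` has
  -- only non-negative terms.
  let y : OpinionState n d := fun a => if a.1 = i then 0 else 1
  have hrow := congrFun (N.laplacian_mulVec_componentVector hL y p i) (i, q)
  have hw : ∀ l r, l ≠ i → r ≠ q → N.weight law ke i l y q r =
      N.K i l q r * law.crossGain ke 1 * law.crossGain ke 1 := fun l r hl hr => by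
    simp [weight, y, hl, hr.symm]
  have hg := law.crossGain_pos hke one_pos
  have hterm : ∀ l, ∑ r, N.weight law ke i l y q r *
      (N.componentVector p i (i, r) - N.componentVector p i (l, r)) =
      N.weight law ke i l y q p *
      (N.componentVector p i (i, p) - N.componentVector p i (l, p)) := fun l => by
    refine Finset.sum_eq_single p (fun r _ hr => ?_) (by simp)
    simp [componentVector, hr]
  rw [laplacian_mulVec_apply, Finset.sum_congr rfl fun l _ => hterm l, Pi.zero_apply,
    Finset.sum_eq_zero_iff_of_nonneg] at hrow
  · have hj := hrow j (Finset.mem_univ j)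
    rw [hw j p hne.symm hpq.symm] at hj
    simp only [componentVector, hij, SimpleGraph.Reachable.refl, and_self, and_false, if_true,
      if_false, sub_zero, mul_one] at hj
    rw [N.symm_topics i j q p] at hj
    exact mul_ne_zero (mul_ne_zero h hg.ne') hg.ne' hj
  · intro l _
    by_cases hl : l = i
    · simp [hl]
    · rw [hw l p hl hpq.symm]
      refine mul_nonneg (mul_nonneg (mul_nonneg (N.nonneg _ _ _ _) hg.le) hg.le) ?_
      simp only [componentVector, SimpleGraph.Reachable.refl, and_self, if_true, true_and]
      split_ifs <;> norm_num

/-! ### Asymptotics of trajectories -/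

section Trajectory

variable {N : OpinionNetwork n d} {law : Feedback} {ke t₀ : ℝ} {x : ℝ → OpinionState n d}

theorem IsTrajectory.hasDerivWithinAt_dotProduct_self (hx : N.IsTrajectory law ke t₀ x)
    {t : ℝ} (ht : t₀ ≤ t) :
    HasDerivWithinAt (fun s => x s ⬝ᵥ x s)
      (-(2 * (x t ⬝ᵥ (N.laplacian law ke (x t)).mulVec (x t)))) (Set.Ici t₀) t := by
  have h := hasDerivWithinAt_pi.1 (hx t ht)
  have h2 := HasDerivWithinAt.fun_sum (u := Finset.univ) fun a _ => (h a).mul (h a)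
  simp only [dotProduct]
  refine h2.congr_deriv ?_
  rw [Finset.mul_sum, ← Finset.sum_neg_distrib]
  refine Finset.sum_congr rfl fun a _ => ?_
  simp only [Pi.neg_apply]
  ring

theorem IsTrajectory.exists_norm_le (hx : N.IsTrajectory law ke t₀ x)
    (hL : ∀ y : OpinionState n d, (N.laplacian law ke y).PosSemidef) :
    ∃ R, ∀ t, t₀ ≤ t → ‖x t‖ ≤ R := by
  have hd := fun t (ht : t₀ ≤ t) => hx.hasDerivWithinAt_dotProduct_self ht
  have hanti : AntitoneOn (fun s => x s ⬝ᵥ x s) (Set.Ici t₀) := by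
    refine antitoneOn_of_hasDerivWithinAt_nonpos (convex_Ici t₀)
      (fun t ht => (hd t ht).continuousWithinAt)
      (fun t ht => (hd t (interior_subset ht)).mono interior_subset) fun t ht => ?_
    have := (hL (x t)).dotProduct_mulVec_nonneg (x t)
    rw [star_trivial] at this
    linarith
  refine ⟨√(x t₀ ⬝ᵥ x t₀), fun t ht => (pi_norm_le_iff_of_nonneg (Real.sqrt_nonneg _)).2
    fun a => Real.le_sqrt_of_sq_le ?_⟩
  refine le_trans ?_ (hanti Set.self_mem_Ici ht ht)
  rw [Real.norm_eq_abs, sq_abs, sq]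
  exact Finset.single_le_sum (f := fun a => x t a * x t a) (fun b _ => mul_self_nonneg _)
    (Finset.mem_univ a)

theorem IsTrajectory.tendsto_dissipation (hx : N.IsTrajectory law ke t₀ x)
    (hL : ∀ y : OpinionState n d, (N.laplacian law ke y).PosSemidef) :
    Tendsto (fun t => 2 * (x t ⬝ᵥ (N.laplacian law ke (x t)).mulVec (x t))) atTop (𝓝 0) := by
  obtain ⟨R, hR⟩ := hx.exists_norm_le hL
  have hc := N.continuous_laplacian_mulVec law ke
  have hball : IsCompact (Metric.closedBall (0 : OpinionState n d) R) := isCompact_closedBall _ _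
  have hmem : Set.MapsTo x (Set.Ici t₀) (Metric.closedBall 0 R) := fun t ht => by
    simpa using hR t ht
  refine tendsto_zero_of_antideriv_nonneg (fun t ht => hx.hasDerivWithinAt_dotProduct_self ht)
    (fun t _ => Finset.sum_nonneg fun a _ => mul_self_nonneg _) (fun t _ => ?_) ?_
  · have := (hL (x t)).dotProduct_mulVec_nonneg (x t)
    rw [star_trivial] at this
    linarith
  -- The velocity is bounded on the ball, so `x` is Lipschitz.
  obtain ⟨M, hM⟩ := hball.exists_bound_of_continuousOn hc.continuousOn
  have hlip : LipschitzOnWith M.toNNReal x (Set.Ici t₀) := by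
    refine (convex_Ici t₀).lipschitzOnWith_of_nnnorm_hasDerivWithin_le hx fun t ht => ?_
    rw [nnnorm_neg, ← NNReal.coe_le_coe, coe_nnnorm]
    exact (hM _ (hmem ht)).trans (Real.le_coe_toNNReal M)
  have hW : Continuous fun y : OpinionState n d =>
      2 * (y ⬝ᵥ (N.laplacian law ke y).mulVec y) :=
    continuous_const.mul (continuous_id.dotProduct hc)
  exact (hball.uniformContinuousOn_of_continuous hW.continuousOn).comp
    hlip.uniformContinuousOn hmem

theorem IsTrajectory.tendsto_sub_of_adj (hke : 0 < ke) (hx : N.IsTrajectory law ke t₀ x)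
    (hL : ∀ y : OpinionState n d, (N.laplacian law ke y).PosSemidef) {i j : Fin n} {p : Fin d}
    (h : (N.topicGraph p).Adj i j) :
    Tendsto (fun t => x t (j, p) - x t (i, p)) atTop (𝓝 0) := by
  obtain ⟨R, hR⟩ := hx.exists_norm_le hL
  have hK : 0 < N.K i j p p := lt_of_le_of_ne (N.nonneg _ _ _ _) h.2.symm
  refine tendsto_zero_of_comp_tendsto_zero (φ := fun z => N.K i j p p *
    (law.directGain ke z * z ^ 2)) (B := R + R) ?_ (fun z hz => ?_) ?_ ?_
  · have := law.continuous_directGain ke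
    fun_prop
  · by_contra hne
    have := law.directGain_pos hke hne
    exact (mul_pos hK (mul_pos this (by positivity))).ne' hz
  · filter_upwards [eventually_ge_atTop t₀] with t ht
    exact (abs_sub _ _).trans (add_le_add ((norm_le_pi_norm (x t) _).trans (hR t ht))
      ((norm_le_pi_norm (x t) _).trans (hR t ht)))
  · refine squeeze_zero (fun t => ?_) (fun t => N.directGain_mul_sq_le hke law (x t) i j p)
      (hx.tendsto_dissipation hL)
    exact mul_nonneg hK.le (mul_nonneg (law.directGain_nonneg _ _) (sq_nonneg _))

theorem IsTrajectory.tendsto_sub_of_reachable (hke : 0 < ke) (hx : N.IsTrajectory law ke t₀ x)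
    (hL : ∀ y : OpinionState n d, (N.laplacian law ke y).PosSemidef) {i j : Fin n} {p : Fin d}
    (h : (N.topicGraph p).Reachable i j) :
    Tendsto (fun t => x t (j, p) - x t (i, p)) atTop (𝓝 0) := by
  obtain ⟨w⟩ := h
  induction w with
  | nil => simp
  | cons hadj _ ih => simpa using ih.add (hx.tendsto_sub_of_adj hke hL hadj)

/-- Conservation of the sum of topic `p` over a component: `1_C e_p` lies in the kernel of the
symmetric matrix `L(x)`. -/
theorem IsTrajectory.componentVector_dotProduct_eq (hx : N.IsTrajectory law ke t₀ x)
    (hL : ∀ y : OpinionState n d, (N.laplacian law ke y).PosSemidef) (p : Fin d) (i : Fin n)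
    {t : ℝ} (ht : t₀ ≤ t) :
    N.componentVector p i ⬝ᵥ x t = N.componentVector p i ⬝ᵥ x t₀ := by
  have hd : ∀ s ∈ Set.Ici t₀,
      HasDerivWithinAt (fun s => N.componentVector p i ⬝ᵥ x s) 0 (Set.Ici t₀) s := fun s hs => by
    have h := hasDerivWithinAt_pi.1 (hx s hs)
    have h2 := HasDerivWithinAt.fun_sum (u := Finset.univ) fun a _ =>
      (h a).const_mul (N.componentVector p i a)
    refine h2.congr_deriv ?_
    change N.componentVector p i ⬝ᵥ -(N.laplacian law ke (x s)).mulVec (x s) = 0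
    have hsymm : (N.laplacian law ke (x s)).transpose = N.laplacian law ke (x s) := by
      rw [← Matrix.conjTranspose_eq_transpose_of_trivial]
      exact (hL (x s)).isHermitian
    rw [dotProduct_neg, Matrix.dotProduct_mulVec, ← Matrix.mulVec_transpose, hsymm,
      N.laplacian_mulVec_componentVector hL, zero_dotProduct, neg_zero]
  have := (convex_Ici t₀).norm_image_sub_le_of_norm_hasDerivWithin_le (C := 0) hd
    (fun s _ => by simp) Set.self_mem_Ici ht
  rw [zero_mul, norm_le_zero_iff, sub_eq_zero] at this
  exact this

/-- Every opinion converges, namely to the conserved average over its component. -/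
theorem IsTrajectory.exists_tendsto (hke : 0 < ke) (hx : N.IsTrajectory law ke t₀ x)
    (hL : ∀ y : OpinionState n d, (N.laplacian law ke y).PosSemidef) (i : Fin n) (p : Fin d) :
    ∃ c, Tendsto (fun t => x t (i, p)) atTop (𝓝 c) := by
  classical
  set C : Finset (Fin n) := Finset.univ.filter fun l => (N.topicGraph p).Reachable i l with hC
  have hcard : (C.card : ℝ) ≠ 0 := by
    have : i ∈ C := Finset.mem_filter.2 ⟨Finset.mem_univ _, SimpleGraph.Reachable.refl _⟩
    exact_mod_cast (Finset.card_pos.2 ⟨i, this⟩).ne'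
  have hdot : ∀ y : OpinionState n d, N.componentVector p i ⬝ᵥ y = ∑ l ∈ C, y (l, p) := fun y => by
    rw [dotProduct, Fintype.sum_prod_type, hC, Finset.sum_filter]
    refine Finset.sum_congr rfl fun l _ => ?_
    rw [Finset.sum_eq_single p (fun q _ hq => by simp [componentVector, hq]) (by simp)]
    simp [componentVector]
  have hsum : Tendsto (fun t => ∑ l ∈ C, (x t (l, p) - x t (i, p))) atTop (𝓝 0) := by
    rw [← Finset.sum_const_zero (s := C)]
    exact tendsto_finsetSum _ fun l hl =>
      hx.tendsto_sub_of_reachable hke hL (Finset.mem_filter.1 hl).2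
  refine ⟨(N.componentVector p i ⬝ᵥ x t₀ - 0) / C.card,
    ((tendsto_const_nhds.sub hsum).div_const _).congr' ?_⟩
  filter_upwards [eventually_ge_atTop t₀] with t ht
  rw [← hx.componentVector_dotProduct_eq hL p i ht, hdot, Finset.sum_sub_distrib,
    Finset.sum_const, nsmul_eq_mul]
  field_simp
  ring

theorem IsTrajectory.reachConsensus_of_reachable (hke : 0 < ke)
    (hx : N.IsTrajectory law ke t₀ x)
    (hL : ∀ y : OpinionState n d, (N.laplacian law ke y).PosSemidef) {i j : Fin n} {p : Fin d}
    (h : (N.topicGraph p).Reachable i j) : ReachConsensus x i j p := by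
  obtain ⟨c, hc⟩ := hx.exists_tendsto hke hL i p
  exact ⟨c, hc, by simpa using (hx.tendsto_sub_of_reachable hke hL h).add hc⟩

end Trajectory

end OpinionNetwork

theorem mainTheorem7 {n d : ℕ} (N : OpinionNetwork n d) (law : Feedback) (ke : ℝ) (hke : 0 < ke)
    (hL : ∀ y : OpinionState n d, (N.laplacian law ke y).PosSemidef)
    (t₀ : ℝ) (x : ℝ → OpinionState n d) (hx : N.IsTrajectory law ke t₀ x)
    (i j : Fin n) (hij : (N.interactionGraph law ke).Adj i j) :
    (∀ p q : Fin d, N.K i j p q ≠ 0 → ReachConsensus x i j p ∧ ReachConsensus x i j q) ∧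
    (∀ p : Fin d, N.K i j p p ≠ 0 → ReachConsensus x i j p) := by
  have key : ∀ p q : Fin d, N.K i j p q ≠ 0 → ReachConsensus x i j p := fun p q h =>
    hx.reachConsensus_of_reachable hke hL (N.reachable_of_coupled hke hL h)
  exact ⟨fun p q h => ⟨key p q h, key q p (by rwa [← N.symm_topics])⟩, fun p h => key p p h⟩
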